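/- Let $f(x)=\tfrac12 x^\top A x$ on $\mathbb R^d$, where $A\in\mathbb R^{d\times d}$ is symmetric with $A=U\Lambda U^\top$, $U^\top U=I_d$ and $\Lambda=\mathrm{diag}(\lambda_1,\dots,\lambda_d)$. Let $\eta>0$, $\sigma\in\mathbb R$, and let the stochastic gradient be $\nabla F(x,\xi)=\nabla f(x)+\xi$ with $\xi\sim\mathcal N(0,\sigma^2 I)$. Fix a deterministic $x_0\in\mathbb R^d$. Let $W$ be a standard $d$-dimensional Wiener process, and let $\sqrt{\eta\Sigma}$ with $\Sigma=\sigma^2 I$ denote any matrix $D\in\mathbb R^{d\times d}$ with $DD^\top=\eta\sigma^2 I$. Functions and quotients of diagonal matrices are taken entrywise on the diagonal, and a quotient of the form $0/0$ is replaced by its limit (see below). 1. (SGD) If $\xi_0,\xi_1,\dots$ are i.i.d. copies of $\xi$ and $x_{k+1}=x_k-\eta\nabla F(x_k,\xi_k)$, then for every $k\ge 0$ $$x_k\sim\mathcal N\Big(U(I-\eta\Lambda)^kU^\top x_0,\ \eta^2\sigma^2\sum_{m=0}^{k-1}U(I-\eta\Lambda)^{2m}U^\top\Big).$$ 2. (SME-1)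 The SDE $dX_t=-\nabla f(X_t)\,dt+\sqrt{\eta\Sigma}\,dW_t$, $X_0=x_0$, has a solution, and every solution satisfies, for every $t\ge0$, $$X_t\sim\mathcal N\Big(e^{-At}x_0,\ \eta\sigma^2\,U\,\frac{I-e^{-2\Lambda t}}{2\Lambda}\,U^\top\Big).$$ 3. (SME-2) The SDE $dX_t=-\nabla\big(f+\tfrac\eta4\|\nabla f\|^2\big)(X_t)\,dt+\sqrt{\eta\Sigma}\,dW_t$, $X_0=x_0$, has a solution, and every solution satisfies, for every $t\ge0$, $$X_t\sim\mathcal N\Big(e^{-(A+\frac\eta2A^2)t}x_0,\ \eta\sigma^2\,U\,\frac{I-e^{-(2\Lambda+\eta\Lambda^2)t}}{2\Lambda+\eta\Lambda^2}\,U^\top\Big).$$ 4. (SPF) If $\eta\|A\|<1$ (spectral norm; that is, $\eta<1/\|A\|$, with no condition when $A=0$), the SDE $$dX_t=U(X_t)\frac{\log(I-\eta\Lambda(X_t))}{\eta\Lambda(X_t)}U(X_t)^\top\nabla f(X_t)\,dt+\sqrt{\eta\Sigma}\,dW_t,\qquad X_0=x_0,$$ where $\nabla^2f(x)=U(x)\Lambda(x)U(x)^\top$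 is an orthogonal eigendecomposition, has a solution, and every solution satisfies, for every $t\ge0$, $$X_t\sim\mathcal N\Big(U(I-\eta\Lambda)^{t/\eta}U^\top x_0,\ \eta^2\sigma^2\,U\,\frac{I-(I-\eta\Lambda)^{2t/\eta}}{-2\log(I-\eta\Lambda)}\,U^\top\Big).$$ The limits used are: $\frac{1-e^{-ct}}{c}:=t$ at $c=0$; $\frac{\log(1-z)}{z}:=-1$ at $z=0$; and $\frac{1-(1-z)^{2t/\eta}}{-2\log(1-z)}:=t/\eta$ at $z=0$. -/

import Mathlib

open MeasureTheory ProbabilityTheory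
open scoped NNReal Gradient

noncomputable section

/-- The quadratic objective `f(x) = ½ xᵀ A x` on `ℝᵈ`. -/
def quadObjective {d : ℕ} (A : Matrix (Fin d) (Fin d) ℝ) (x : EuclideanSpace ℝ (Fin d)) : ℝ :=
  (1 / 2) * inner ℝ x (Matrix.toEuclideanCLM (𝕜 := ℝ) A x)

/-- The Hessian matrix `[∇² f(x)]ᵢⱼ = ∂ⱼ (∇ f)ᵢ (x)`. -/
def hessianMatrix {d : ℕ} (f : EuclideanSpace ℝ (Fin d) → ℝ) (x : EuclideanSpace ℝ (Fin d)) :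
    Matrix (Fin d) (Fin d) ℝ :=
  Matrix.of fun i j => (fderiv ℝ (fun y => ∇ f y) x (EuclideanSpace.single j 1)) i

/-- The stochastic gradient is the true gradient plus the noise:
`∇ F(x, ξ) = ∇ f(x) + ξ`, the gradient being taken in the variable `x`. -/
def HasAdditiveNoise {d : ℕ}
    (F : EuclideanSpace ℝ (Fin d) → EuclideanSpace ℝ (Fin d) → ℝ)
    (f : EuclideanSpace ℝ (Fin d) → ℝ) : Prop :=
  ∀ x ξ, HasGradientAt (fun y => F y ξ) (∇ f x + ξ) x

/-- The iterates `x_{k+1} = x_k - η_k ∇ F(x_k, ξ_k)` of stochastic gradient descent. -/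
def sgdIterate {d : ℕ} {Ω : Type*} (η : ℕ → ℝ)
    (F : EuclideanSpace ℝ (Fin d) → EuclideanSpace ℝ (Fin d) → ℝ)
    (ξ : ℕ → Ω → EuclideanSpace ℝ (Fin d)) (x₀ : EuclideanSpace ℝ (Fin d)) :
    ℕ → Ω → EuclideanSpace ℝ (Fin d)
  | 0, _ => x₀
  | k + 1, ω => sgdIterate η F ξ x₀ k ω - η k • ∇ (fun y => F y (ξ k ω)) (sgdIterate η F ξ x₀ k ω)

/-- Standard Wiener process in `ℝᵈ`: its coordinates are independent real Brownian motions. -/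
structure IsWienerProcess {d : ℕ} {Ω : Type*} [MeasurableSpace Ω]
    (W : ℝ≥0 → Ω → EuclideanSpace ℝ (Fin d)) (P : Measure Ω) : Prop where
  coord : ∀ i, IsBrownianReal (fun t ω => W t ω i) P
  indep : iIndepFun (fun (i : Fin d) (ω : Ω) (t : ℝ≥0) => W t ω i) P

/-- `X` is a solution, driven by `W` and started at `x₀`, of the SDE with additive noise
`dX_t = b(X_t) dt + D dW_t`. As the diffusion coefficient `D` is a constant matrix, the
stochastic integral `∫₀ᵗ D dW_s` is `D W_t`. -/
structure IsSDESolution {d : ℕ} {Ω : Type*} [MeasurableSpace Ω]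
    (b : EuclideanSpace ℝ (Fin d) → EuclideanSpace ℝ (Fin d)) (D : Matrix (Fin d) (Fin d) ℝ)
    (x₀ : EuclideanSpace ℝ (Fin d)) (W X : ℝ≥0 → Ω → EuclideanSpace ℝ (Fin d))
    (P : Measure Ω) : Prop where
  aemeasurable : ∀ t, AEMeasurable (X t) P
  continuous_paths : ∀ᵐ ω ∂P, Continuous fun t => X t ω
  integral_eq : ∀ᵐ ω ∂P, ∀ t : ℝ≥0,
    X t ω = x₀ + (∫ s in (0 : ℝ)..t, b (X s.toNNReal ω)) +
      Matrix.toEuclideanCLM (𝕜 := ℝ) D (W t ω)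

/-- `B` is a square root of `S` in the sense `B Bᵀ = S`. -/
def IsMatrixSqrt {d : ℕ} (B S : Matrix (Fin d) (Fin d) ℝ) : Prop :=
  B * B.transpose = S

/-- Drift of SME-1: `-∇ f(x)`. -/
def sme1Drift {d : ℕ} (f : EuclideanSpace ℝ (Fin d) → ℝ) (x : EuclideanSpace ℝ (Fin d)) :
    EuclideanSpace ℝ (Fin d) :=
  -∇ f x

/-- Drift of SME-2: `-∇ (f + (η / 4) ‖∇ f‖²)(x)`. -/
def sme2Drift {d : ℕ} (η : ℝ) (f : EuclideanSpace ℝ (Fin d) → ℝ)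
    (x : EuclideanSpace ℝ (Fin d)) : EuclideanSpace ℝ (Fin d) :=
  -∇ (fun y => f y + η / 4 * ‖∇ f y‖ ^ 2) x

/-- `log (1 - z) / z`, with its limit `-1` at `z = 0`. -/
def logQuot (z : ℝ) : ℝ :=
  if z = 0 then -1 else Real.log (1 - z) / z

/-- Drift of SPF: `U(x) (log (I - η Λ(x)) / (η Λ(x))) U(x)ᵀ ∇ f(x)`, where
`∇² f(x) = U(x) Λ(x) U(x)ᵀ` is an orthogonal eigendecomposition; the matrix in front of the gradient
is the functional calculus of the symmetric matrix `∇² f(x)`. -/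
def spfDrift {d : ℕ} (η : ℝ) (f : EuclideanSpace ℝ (Fin d) → ℝ)
    (x : EuclideanSpace ℝ (Fin d)) : EuclideanSpace ℝ (Fin d) :=
  Matrix.toEuclideanCLM (𝕜 := ℝ) (cfc (fun z => logQuot (η * z)) (hessianMatrix f x)) (∇ f x)

/-- `(1 - exp (-c t)) / c`, with its limit `t` at `c = 0`. -/
def expQuot (t c : ℝ) : ℝ :=
  if c = 0 then t else (1 - Real.exp (-(c * t))) / c

/-- `(1 - (1 - z) ^ (2 s)) / (-2 log (1 - z))`, with its limit `s` at `z = 0`. -/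
def powQuot (s z : ℝ) : ℝ :=
  if z = 0 then s else (1 - (1 - z) ^ (2 * s)) / (-2 * Real.log (1 - z))

end

/-! For quadratic `f` the gradient `A x` is linear, so all four processes are linear systems driven
by additive Gaussian noise, and their laws can be read off from characteristic functions.

SGD unrolls to `(I - ηA)^k x₀` plus a finite sum of matrices applied to the independent noises. The
exponents in the characteristic functions add up to a quadratic form diagonal in `Uᵀu`.

In each SDE the drift is `U diag(μ) Uᵀ x`, where `μ` is `-λ`, `-(λ + ηλ²/2)` or `log(1 - ηλ)/η`, so
`linearSDE_exists_and_hasLaw` treats all three. No Itô calculus is needed. In the coordinates `Uᵀ X`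
the drift decouples, and along each continuous noise path one must solve `y = a + μ ∫ y + n`. An
integrating factor gives the unique solution `ouPath`, hence both existence and a formula for every
solution.

For the law, `ouPath - e^{μt} a` is the pathwise limit of the sums `∑ e^{μ(t - t_k)} (n(t_{k+1}) -
n(t_k))`, by integration by parts (`tendsto_sum_mul_sub_of_hasDerivAt`). These sums are linear in
independent Gaussian increments, so their characteristic functions are explicit. The variances
converge to `∫₀ᵗ e^{2μs} ds`, which is `expQuot`, and dominated convergence passes to the limit.
Since `D Dᵀ` is scalar, rotation by `Uᵀ` leaves the noise covariance unchanged, so the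
eigencoordinates have diagonal covariance. -/

section Quadratic

/-! ### Gradient and Hessian of the quadratic objective. -/

variable {d : ℕ}

lemma Matrix.toEuclideanCLM_mul_apply (A B : Matrix (Fin d) (Fin d) ℝ)
    (x : EuclideanSpace ℝ (Fin d)) :
    Matrix.toEuclideanCLM (𝕜 := ℝ) (A * B) x =
      Matrix.toEuclideanCLM (𝕜 := ℝ) A (Matrix.toEuclideanCLM (𝕜 := ℝ) B x) := by
  rw [map_mul]; rfl

lemma Matrix.inner_toEuclideanCLM_left (A : Matrix (Fin d) (Fin d) ℝ)
    (x y : EuclideanSpace ℝ (Fin d)) :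
    inner ℝ (Matrix.toEuclideanCLM (𝕜 := ℝ) A x) y =
      inner ℝ x (Matrix.toEuclideanCLM (𝕜 := ℝ) A.transpose y) := by
  rw [real_inner_comm, Matrix.inner_toEuclideanCLM, Matrix.inner_toEuclideanCLM,
    Matrix.dotProduct_mulVec, Matrix.mulVec_transpose, dotProduct_comm]

lemma hasGradientAt_quadObjective {A : Matrix (Fin d) (Fin d) ℝ} (hA : A.IsSymm)
    (x : EuclideanSpace ℝ (Fin d)) :
    HasGradientAt (quadObjective A) (Matrix.toEuclideanCLM (𝕜 := ℝ) A x) x := by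
  rw [hasGradientAt_iff_hasFDerivAt]
  have h := ((hasFDerivAt_id x).inner ℝ
    ((Matrix.toEuclideanCLM (𝕜 := ℝ) A).hasFDerivAt (x := x))).const_mul (1 / 2 : ℝ)
  refine h.congr_fderiv ?_
  ext y
  have := Matrix.inner_toEuclideanCLM_left A x y
  rw [hA] at this
  have h' := real_inner_comm y (Matrix.toEuclideanCLM (𝕜 := ℝ) A x)
  simp [fderivInnerCLM_apply, this] at h' ⊢
  linarith

lemma gradient_quadObjective {A : Matrix (Fin d) (Fin d) ℝ} (hA : A.IsSymm) :
    ∇ (quadObjective A) = fun x => Matrix.toEuclideanCLM (𝕜 := ℝ) A x :=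
  funext fun x => (hasGradientAt_quadObjective hA x).gradient

lemma hessianMatrix_quadObjective {A : Matrix (Fin d) (Fin d) ℝ} (hA : A.IsSymm)
    (x : EuclideanSpace ℝ (Fin d)) : hessianMatrix (quadObjective A) x = A := by
  ext i j
  simp only [hessianMatrix, gradient_quadObjective hA, Matrix.of_apply]
  rw [ContinuousLinearMap.fderiv, Matrix.ofLp_toEuclideanCLM]
  simp

/-- Since `‖Ax‖² = xᵀA²x`, the modified objective is again quadratic, so the SME-2 drift is linear
like that of SME-1. -/
lemma quadObjective_add_norm_sq_gradient {A : Matrix (Fin d) (Fin d) ℝ} (hA : A.IsSymm) (η : ℝ) :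
    (fun y => quadObjective A y + η / 4 * ‖∇ (quadObjective A) y‖ ^ 2) =
      quadObjective (A + (η / 2) • A ^ 2) := by
  ext y
  rw [gradient_quadObjective hA, ← real_inner_self_eq_norm_sq, Matrix.inner_toEuclideanCLM_left, hA,
    ← Matrix.toEuclideanCLM_mul_apply, ← sq, quadObjective, quadObjective, map_add, map_smul,
    add_apply, inner_add_right, smul_apply,
    real_inner_smul_right]
  ring

end Quadratic

/-! ### Functional calculus of `U diag(a) Uᵀ`. -/

section ConjDiagonal

variable {d : ℕ} {U : Matrix (Fin d) (Fin d) ℝ}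

open Matrix in
lemma Matrix.conj_diagonal_mul (hU : Uᵀ * U = 1) (a b : Fin d → ℝ) :
    (U * diagonal a * Uᵀ) * (U * diagonal b * Uᵀ) = U * diagonal (fun i => a i * b i) * Uᵀ := by
  rw [← diagonal_mul_diagonal]
  calc _ = U * diagonal a * (Uᵀ * U) * diagonal b * Uᵀ := by simp only [Matrix.mul_assoc]
    _ = _ := by rw [hU, Matrix.mul_one]; simp only [Matrix.mul_assoc]

open Matrix in
lemma Matrix.isSymm_conj_diagonal (a : Fin d → ℝ) : (U * diagonal a * Uᵀ).IsSymm := by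
  simp [IsSymm, Matrix.mul_assoc]

open Matrix in
lemma Matrix.conj_diagonal_add (a b : Fin d → ℝ) :
    (U * diagonal a * Uᵀ) + (U * diagonal b * Uᵀ) = U * diagonal (fun i => a i + b i) * Uᵀ := by
  rw [← diagonal_add, Matrix.mul_add, Matrix.add_mul]

open Matrix in
lemma Matrix.smul_conj_diagonal (c : ℝ) (a : Fin d → ℝ) :
    c • (U * diagonal a * Uᵀ) = U * diagonal (fun i => c * a i) * Uᵀ := by
  rw [show (fun i => c * a i) = c • a from rfl, diagonal_smul, Matrix.mul_smul, Matrix.smul_mul]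

open Matrix in
lemma Matrix.conj_diagonal_pow (hU : Uᵀ * U = 1) (a : Fin d → ℝ) (n : ℕ) :
    (U * diagonal a * Uᵀ) ^ n = U * diagonal (fun i => a i ^ n) * Uᵀ := by
  induction n with
  | zero => simp [mul_eq_one_comm.mp hU]
  | succ n ih => rw [pow_succ, ih, conj_diagonal_mul hU]; simp only [pow_succ]

open Matrix in
lemma Matrix.exp_conj_diagonal (hU : Uᵀ * U = 1) (a : Fin d → ℝ) :
    NormedSpace.exp (U * diagonal a * Uᵀ) = U * diagonal (fun i => Real.exp (a i)) * Uᵀ := by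
  have h : Uᵀ = U⁻¹ := (inv_eq_left_inv hU).symm
  rw [h, exp_conj _ _ (IsUnit.of_mul_eq_one_right _ hU), exp_diagonal]
  congr
  ext i
  rw [Pi.coe_exp, Real.exp_eq_exp_ℝ]

open Matrix in
lemma Matrix.aeval_conj_diagonal (hU : Uᵀ * U = 1) (a : Fin d → ℝ) (p : Polynomial ℝ) :
    Polynomial.aeval (U * diagonal a * Uᵀ) p = U * diagonal (fun i => p.eval (a i)) * Uᵀ := by
  induction p using Polynomial.induction_on' with
  | add p q hp hq => simp [hp, hq, conj_diagonal_add]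
  | monomial n c =>
    rw [Polynomial.aeval_monomial, conj_diagonal_pow hU, ← Algebra.smul_def, smul_conj_diagonal]
    simp

open Matrix in
lemma Matrix.conj_diagonal_apply (hU : Uᵀ * U = 1) (a : Fin d → ℝ) (x : EuclideanSpace ℝ (Fin d))
    (i : Fin d) :
    toEuclideanCLM (𝕜 := ℝ) Uᵀ (toEuclideanCLM (𝕜 := ℝ) (U * diagonal a * Uᵀ) x) i =
      a i * toEuclideanCLM (𝕜 := ℝ) Uᵀ x i := by
  rw [← toEuclideanCLM_mul_apply, ← Matrix.mul_assoc, ← Matrix.mul_assoc, hU, Matrix.one_mul,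
    toEuclideanCLM_mul_apply, ofLp_toEuclideanCLM, mulVec_diagonal]

open Matrix in
lemma Matrix.toEuclideanCLM_transpose_cancel (hU : Uᵀ * U = 1) (x : EuclideanSpace ℝ (Fin d)) :
    toEuclideanCLM (𝕜 := ℝ) U (toEuclideanCLM (𝕜 := ℝ) Uᵀ x) = x := by
  rw [← toEuclideanCLM_mul_apply, mul_eq_one_comm.mp hU]; simp

open Matrix in
lemma Matrix.toEuclideanCLM_transpose_cancel' (hU : Uᵀ * U = 1) (x : EuclideanSpace ℝ (Fin d)) :
    toEuclideanCLM (𝕜 := ℝ) Uᵀ (toEuclideanCLM (𝕜 := ℝ) U x) = x := by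
  rw [← toEuclideanCLM_mul_apply, hU]; simp

open Matrix in
lemma Matrix.spectrum_conj_diagonal_subset (hU : Uᵀ * U = 1) (a : Fin d → ℝ) :
    spectrum ℝ (U * diagonal a * Uᵀ) ⊆ Set.range a := by
  intro r hr
  by_contra h
  refine hr ?_
  have h1 : algebraMap ℝ (Matrix (Fin d) (Fin d) ℝ) r = U * diagonal (fun _ => r) * Uᵀ := by
    have := aeval_conj_diagonal hU a (Polynomial.C r)
    simpa using this
  rw [spectrum.mem_resolventSet_iff, h1, sub_eq_add_neg,
    ← neg_one_smul ℝ (U * diagonal a * Uᵀ), smul_conj_diagonal,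
    conj_diagonal_add]
  refine IsUnit.of_mul_eq_one (U * diagonal (fun i => (r + -1 * a i)⁻¹) * Uᵀ) ?_
  rw [conj_diagonal_mul hU]
  have : (fun i => (r + -1 * a i) * (r + -1 * a i)⁻¹) = fun _ => 1 := by
    ext i
    refine mul_inv_cancel₀ fun h0 => h ⟨i, by linarith⟩
  rw [this, diagonal_one, Matrix.mul_one, mul_eq_one_comm.mp hU]

open Matrix in
-- The spectrum lies in the finite set of values of `a`, where any `f` agrees with its Lagrange
-- interpolant; this reduces `cfc` to the polynomial case.
lemma Matrix.cfc_conj_diagonal (hU : Uᵀ * U = 1) (a : Fin d → ℝ) (f : ℝ → ℝ) :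
    cfc f (U * diagonal a * Uᵀ) = U * diagonal (fun i => f (a i)) * Uᵀ := by
  classical
  set p : Polynomial ℝ := Lagrange.interpolate (Finset.univ.image a) id f with hp
  have hpe : ∀ i, p.eval (a i) = f (a i) := fun i =>
    Lagrange.eval_interpolate_at_node f (Set.injOn_id _) (by simp : a i ∈ Finset.univ.image a)
  have hsa : IsSelfAdjoint (U * diagonal a * Uᵀ) := by
    rw [isSelfAdjoint_iff, star_eq_conjTranspose, conjTranspose_eq_transpose_of_trivial]
    exact isSymm_conj_diagonal a
  have : (spectrum ℝ (U * diagonal a * Uᵀ)).EqOn f p.eval := by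
    intro r hr
    obtain ⟨i, rfl⟩ := spectrum_conj_diagonal_subset hU a hr
    exact (hpe i).symm
  rw [cfc_congr this, cfc_polynomial p _ hsa, aeval_conj_diagonal hU]
  simp [hpe]

open Matrix in
lemma Matrix.abs_le_norm_conj_diagonal (hU : Uᵀ * U = 1) (a : Fin d → ℝ) (i : Fin d) :
    |a i| ≤ ‖toEuclideanCLM (𝕜 := ℝ) (U * diagonal a * Uᵀ)‖ := by
  -- The `i`-th column of `U` is an eigenvector with eigenvalue `a i`.
  set v := toEuclideanCLM (𝕜 := ℝ) U (EuclideanSpace.single i 1) with hv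
  have hv0 : v ≠ 0 := by
    intro h
    have := toEuclideanCLM_transpose_cancel' hU (EuclideanSpace.single i 1)
    rw [← hv, h, map_zero] at this
    simpa using congrArg (fun w => w i) this
  have hAv : toEuclideanCLM (𝕜 := ℝ) (U * diagonal a * Uᵀ) v = a i • v := by
    rw [hv, ← toEuclideanCLM_mul_apply, Matrix.mul_assoc, hU, Matrix.mul_one,
      toEuclideanCLM_mul_apply, ← map_smul]
    congr 1
    ext j
    rw [ofLp_toEuclideanCLM, mulVec_diagonal]
    by_cases h : j = i <;> simp [h]
  have := (toEuclideanCLM (𝕜 := ℝ) (U * diagonal a * Uᵀ)).le_opNorm v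
  rw [hAv, norm_smul, Real.norm_eq_abs] at this
  exact le_of_mul_le_mul_right this (norm_pos_iff.mpr hv0)

open Matrix in
lemma Matrix.posSemidef_conj_diagonal {a : Fin d → ℝ} (ha : ∀ i, 0 ≤ a i) :
    (U * diagonal a * Uᵀ).PosSemidef := by
  have := (PosSemidef.diagonal (d := a) ha).mul_mul_conjTranspose_same U
  rwa [conjTranspose_eq_transpose_of_trivial] at this

open Matrix in
lemma Matrix.dotProduct_conj_diagonal (a : Fin d → ℝ) (x : EuclideanSpace ℝ (Fin d)) :
    x ⬝ᵥ (U * diagonal a * Uᵀ) *ᵥ x = ∑ i, a i * toEuclideanCLM (𝕜 := ℝ) Uᵀ x i ^ 2 := by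
  rw [← inner_toEuclideanCLM, Matrix.mul_assoc, toEuclideanCLM_mul_apply, real_inner_comm,
    inner_toEuclideanCLM_left, toEuclideanCLM_mul_apply, PiLp.inner_apply]
  refine Finset.sum_congr rfl fun i _ => ?_
  rw [ofLp_toEuclideanCLM _ (toEuclideanCLM (𝕜 := ℝ) Uᵀ x), mulVec_diagonal]
  simp only [RCLike.inner_apply, conj_trivial]
  ring

end ConjDiagonal

/-! ### Gaussian laws through characteristic functions. -/

section Gaussian

variable {d : ℕ} {Ω : Type*} [MeasurableSpace Ω] {P : Measure Ω}

open Matrix in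
-- The covariance form is diagonal in the coordinates `Uᵀu`. The sign condition on `v` gives the
-- positive semidefiniteness under which the Gaussian characteristic function is available.
lemma hasLaw_multivariateGaussian_of_charFun [IsProbabilityMeasure P]
    {X : Ω → EuclideanSpace ℝ (Fin d)} (hX : AEMeasurable X P) {m : EuclideanSpace ℝ (Fin d)}
    {U : Matrix (Fin d) (Fin d) ℝ} {v : Fin d → ℝ} (hv : ∀ i, 0 ≤ v i)
    (h : ∀ u, charFun (P.map X) u = Complex.exp ((inner ℝ u m : ℝ) * Complex.I -
      ((∑ i, v i * toEuclideanCLM (𝕜 := ℝ) Uᵀ u i ^ 2 : ℝ) : ℂ) / 2)) :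
    HasLaw X (multivariateGaussian m (U * diagonal v * Uᵀ)) P := by
  refine ⟨hX, ?_⟩
  have := Measure.isProbabilityMeasure_map hX
  refine Measure.ext_of_charFun (funext fun u => ?_)
  rw [h, charFun_multivariateGaussian (posSemidef_conj_diagonal hv), dotProduct_conj_diagonal]

open Matrix in
lemma charFun_map_toEuclideanCLM {ξ : Ω → EuclideanSpace ℝ (Fin d)} {s : ℝ}
    (hξ : HasLaw ξ (multivariateGaussian 0 (s ^ 2 • (1 : Matrix (Fin d) (Fin d) ℝ))) P)
    (L : Matrix (Fin d) (Fin d) ℝ) (u : EuclideanSpace ℝ (Fin d)) :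
    charFun (P.map fun ω => toEuclideanCLM (𝕜 := ℝ) L (ξ ω)) u =
      Complex.exp (-((s ^ 2 * ‖toEuclideanCLM (𝕜 := ℝ) Lᵀ u‖ ^ 2 : ℝ) : ℂ) / 2) := by
  have h1 : charFun (P.map fun ω => toEuclideanCLM (𝕜 := ℝ) L (ξ ω)) u =
      charFun (P.map ξ) (toEuclideanCLM (𝕜 := ℝ) Lᵀ u) := by
    rw [charFun_apply, charFun_apply, integral_map (by fun_prop) (by fun_prop),
      integral_map (by fun_prop) (by fun_prop)]
    simp only [inner_toEuclideanCLM_left]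
  rw [h1, hξ.map_eq, charFun_multivariateGaussian (PosSemidef.one.smul (sq_nonneg s)),
    smul_mulVec, one_mulVec, dotProduct_smul]
  have h2 : (toEuclideanCLM (𝕜 := ℝ) Lᵀ u).ofLp ⬝ᵥ (toEuclideanCLM (𝕜 := ℝ) Lᵀ u).ofLp =
      ‖toEuclideanCLM (𝕜 := ℝ) Lᵀ u‖ ^ 2 := by
    rw [← real_inner_self_eq_norm_sq, PiLp.inner_apply]
    rfl
  rw [h2, inner_zero_right, smul_eq_mul, Complex.ofReal_zero, zero_mul, zero_sub, neg_div]

open Matrix in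
lemma charFun_map_const_add_sum_toEuclideanCLM [IsProbabilityMeasure P]
    {ξ : ℕ → Ω → EuclideanSpace ℝ (Fin d)} {s : ℝ} (hind : iIndepFun ξ P)
    (hξ : ∀ k, HasLaw (ξ k) (multivariateGaussian 0 (s ^ 2 • (1 : Matrix (Fin d) (Fin d) ℝ))) P)
    (m : EuclideanSpace ℝ (Fin d)) (L : ℕ → Matrix (Fin d) (Fin d) ℝ) (n : ℕ)
    (u : EuclideanSpace ℝ (Fin d)) :
    charFun (P.map fun ω => m + ∑ k ∈ Finset.range n, toEuclideanCLM (𝕜 := ℝ) (L k) (ξ k ω)) u =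
      Complex.exp ((inner ℝ u m : ℝ) * Complex.I -
        ((∑ k ∈ Finset.range n, s ^ 2 * ‖toEuclideanCLM (𝕜 := ℝ) (L k)ᵀ u‖ ^ 2 : ℝ) : ℂ) / 2) := by
  have hm : ∀ k, AEMeasurable (ξ k) P := fun k => (hξ k).aemeasurable
  have hi : iIndepFun (fun k ω => toEuclideanCLM (𝕜 := ℝ) (L k) (ξ k ω)) P :=
    hind.comp (fun k => toEuclideanCLM (𝕜 := ℝ) (L k)) fun k => by fun_prop
  have h0 : (P.map fun ω => m + ∑ k ∈ Finset.range n, toEuclideanCLM (𝕜 := ℝ) (L k) (ξ k ω)) =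
      (P.map fun ω => ∑ k ∈ Finset.range n, toEuclideanCLM (𝕜 := ℝ) (L k) (ξ k ω)).map
        (fun x => m + x) := by
    rw [AEMeasurable.map_map_of_aemeasurable (by fun_prop)
      (Finset.aemeasurable_fun_sum _ fun k _ => by fun_prop)]
    rfl
  rw [h0, charFun_map_const_add, (hi.restrict _).charFun_map_fun_finsetSum_eq_prod
    (fun k _ => by fun_prop), Finset.prod_apply]
  simp only [charFun_map_toEuclideanCLM (hξ _)]
  rw [← Complex.exp_sum, ← Complex.exp_add]
  congr 1
  rw [real_inner_comm]
  push_cast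
  rw [← Finset.sum_div, Finset.sum_neg_distrib]
  ring

end Gaussian

/-! ### Unrolling the SGD recursion and its law. -/

section SGD

variable {d : ℕ} {Ω : Type*}

open Matrix in
lemma sgdIterate_eq_sum {A : Matrix (Fin d) (Fin d) ℝ} (hA : A.IsSymm) (η : ℝ)
    {F : EuclideanSpace ℝ (Fin d) → EuclideanSpace ℝ (Fin d) → ℝ}
    (hF : HasAdditiveNoise F (quadObjective A)) (ξ : ℕ → Ω → EuclideanSpace ℝ (Fin d))
    (x₀ : EuclideanSpace ℝ (Fin d)) (k : ℕ) (ω : Ω) :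
    sgdIterate (fun _ => η) F ξ x₀ k ω = toEuclideanCLM (𝕜 := ℝ) ((1 - η • A) ^ k) x₀ +
      ∑ m ∈ Finset.range k, toEuclideanCLM (𝕜 := ℝ) ((-η) • (1 - η • A) ^ (k - 1 - m)) (ξ m ω) := by
  induction k with
  | zero => simp [sgdIterate]
  | succ k ih =>
    have hstep : ∀ y, y - η • (∇ (quadObjective A) y + ξ k ω) =
        toEuclideanCLM (𝕜 := ℝ) (1 - η • A) y + toEuclideanCLM (𝕜 := ℝ) ((-η) • 1) (ξ k ω) := by
      intro y
      simp [gradient_quadObjective hA]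
      abel
    rw [sgdIterate, (hF _ _).gradient, hstep, ih, map_add, map_sum, pow_succ',
      toEuclideanCLM_mul_apply, Finset.sum_range_succ, add_assoc]
    congr 2
    · refine Finset.sum_congr rfl fun m hm => ?_
      -- The subtraction is truncated, so `m < k` is needed here.
      have : k + 1 - 1 - m = (k - 1 - m) + 1 := by
        have := Finset.mem_range.mp hm
        omega
      rw [← toEuclideanCLM_mul_apply, this, pow_succ', Matrix.mul_smul]
    · simp

open Matrix in
lemma hasLaw_sgdIterate [MeasurableSpace Ω] {P : Measure Ω} [IsProbabilityMeasure P]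
    {A U : Matrix (Fin d) (Fin d) ℝ} {lam : Fin d → ℝ}
    (hU : Uᵀ * U = 1) (hdecomp : A = U * diagonal lam * Uᵀ) (η σ : ℝ)
    {F : EuclideanSpace ℝ (Fin d) → EuclideanSpace ℝ (Fin d) → ℝ}
    (hF : HasAdditiveNoise F (quadObjective A)) {ξ : ℕ → Ω → EuclideanSpace ℝ (Fin d)}
    (hind : iIndepFun ξ P)
    (hξ : ∀ k, HasLaw (ξ k) (multivariateGaussian 0 (σ ^ 2 • (1 : Matrix (Fin d) (Fin d) ℝ))) P)
    (x₀ : EuclideanSpace ℝ (Fin d)) (k : ℕ) :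
    HasLaw (sgdIterate (fun _ => η) F ξ x₀ k)
      (multivariateGaussian
        (toEuclideanCLM (𝕜 := ℝ) (U * (1 - η • diagonal lam) ^ k * Uᵀ) x₀)
        ((η ^ 2 * σ ^ 2) • ∑ m ∈ Finset.range k, U * (1 - η • diagonal lam) ^ (2 * m) * Uᵀ)) P := by
  have hA : A.IsSymm := hdecomp ▸ isSymm_conj_diagonal lam
  set a : Fin d → ℝ := fun i => 1 - η * lam i with ha
  have hdiag : (1 : Matrix (Fin d) (Fin d) ℝ) - η • diagonal lam = diagonal a := by
    rw [← diagonal_one, ← diagonal_smul, diagonal_sub]; rfl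
  have hM : (1 : Matrix (Fin d) (Fin d) ℝ) - η • A = U * diagonal a * Uᵀ := by
    rw [← hdiag, Matrix.mul_sub, Matrix.sub_mul, Matrix.mul_one, mul_eq_one_comm.mp hU, hdecomp,
      Matrix.mul_smul, Matrix.smul_mul]
  have hcov : (η ^ 2 * σ ^ 2) • ∑ m ∈ Finset.range k, U * (1 - η • diagonal lam) ^ (2 * m) * Uᵀ =
      U * diagonal (fun i => η ^ 2 * σ ^ 2 * ∑ m ∈ Finset.range k, a i ^ (2 * m)) * Uᵀ := by
    rw [← smul_conj_diagonal, hdiag]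
    congr 1
    simp only [diagonal_pow, ← Finset.sum_mul, ← Finset.mul_sum]
    congr 2
    ext i j
    rw [Matrix.sum_apply]
    by_cases hij : i = j
    · subst hij; simp
    · simp [hij]
  have hX : sgdIterate (fun _ => η) F ξ x₀ k = _ :=
    funext fun ω => sgdIterate_eq_sum hA η hF ξ x₀ k ω
  have hm : ∀ k, AEMeasurable (ξ k) P := fun k => (hξ k).aemeasurable
  have hmean : U * (1 - η • diagonal lam) ^ k * Uᵀ = (1 - η • A) ^ k := by
    rw [hM, conj_diagonal_pow hU, hdiag, diagonal_pow]; rfl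
  rw [hcov, hX, hmean]
  refine hasLaw_multivariateGaussian_of_charFun
    ((Finset.aemeasurable_fun_sum _ fun k _ => by fun_prop).const_add _)
    (fun i => mul_nonneg (by positivity)
      (Finset.sum_nonneg fun m _ => by rw [pow_mul]; positivity)) fun u => ?_
  rw [charFun_map_const_add_sum_toEuclideanCLM hind hξ]
  congr 4
  have hterm : ∀ j, ‖toEuclideanCLM (𝕜 := ℝ) (((-η) • (1 - η • A) ^ j)ᵀ) u‖ ^ 2 =
      ∑ i, η ^ 2 * a i ^ (2 * j) * toEuclideanCLM (𝕜 := ℝ) Uᵀ u i ^ 2 := by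
    intro j
    rw [hM, conj_diagonal_pow hU, smul_conj_diagonal, isSymm_conj_diagonal,
      ← real_inner_self_eq_norm_sq, inner_toEuclideanCLM_left, isSymm_conj_diagonal,
      ← toEuclideanCLM_mul_apply, conj_diagonal_mul hU, inner_toEuclideanCLM,
      dotProduct_conj_diagonal]
    refine Finset.sum_congr rfl fun i _ => ?_
    ring
  simp only [hterm]
  -- The noise of step `m` carries the power `k - 1 - m`; reversing the sum gives the order used in
  -- the stated covariance.
  rw [Finset.sum_range_reflect (fun j =>
    σ ^ 2 * ∑ i, η ^ 2 * a i ^ (2 * j) * toEuclideanCLM (𝕜 := ℝ) Uᵀ u i ^ 2), ← Finset.mul_sum,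
    Finset.sum_comm, Finset.mul_sum]
  refine Finset.sum_congr rfl fun i _ => ?_
  rw [← Finset.sum_mul, ← Finset.mul_sum]
  ring

end SGD

/-! ### Riemann–Stieltjes sums of a smooth function against a continuous path. -/

section RiemannStieltjes

open Filter Topology intervalIntegral

/-- Integration by parts moves the differential onto `g`, so `w` need not have bounded variation,
and Brownian paths are allowed. -/
lemma tendsto_sum_mul_sub_of_hasDerivAt {g g' w : ℝ → ℝ} {t : ℝ} (ht : 0 ≤ t)
    (hg : ∀ s, HasDerivAt g (g' s) s) (hg' : Continuous g') (hw : Continuous w) :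
    Tendsto (fun n : ℕ => ∑ k ∈ Finset.range n,
        g (t * k / n) * (w (t * (k + 1 : ℕ) / n) - w (t * k / n))) atTop
      (𝓝 (g t * w t - g 0 * w 0 - ∫ s in (0 : ℝ)..t, g' s * w s)) := by
  obtain ⟨M, hM⟩ := isCompact_Icc.exists_bound_of_continuousOn (s := Set.Icc 0 t) hg'.continuousOn
  have hM0 : 0 ≤ M := (norm_nonneg _).trans (hM 0 ⟨le_rfl, ht⟩)
  have huc := isCompact_Icc.uniformContinuousOn_of_continuous (s := Set.Icc 0 t) hw.continuousOn
  rw [Metric.uniformContinuousOn_iff] at huc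
  rw [Metric.tendsto_atTop]
  intro ε hε
  -- The total error will be at most `M * t` times this modulus; the `+ 1` covers `M * t = 0` and
  -- makes the final bound strict.
  obtain ⟨δ, hδ, hwδ⟩ := huc (ε / (M * t + 1)) (by positivity)
  obtain ⟨n₀, hn₀⟩ := exists_nat_gt (t / δ)
  refine ⟨n₀ + 1, fun n hn => ?_⟩
  have hn' : (0 : ℝ) < n := by exact_mod_cast (by omega : 0 < n)
  have hmesh : t / n < δ := by
    rw [div_lt_iff₀ hn', mul_comm]
    rw [div_lt_iff₀ hδ] at hn₀
    have : (n₀ : ℝ) ≤ n := by exact_mod_cast (by omega : n₀ ≤ n)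
    nlinarith
  set p : ℕ → ℝ := fun k => t * k / n with hp
  have hp0 : p 0 = 0 := by simp [hp]
  have hpn : p n = t := by simp [hp, hn'.ne']
  have hpstep : ∀ k, p (k + 1) - p k = t / n := fun k => by simp only [hp]; push_cast; ring
  have hpmono : Monotone p := monotone_nat_of_le_succ fun k => by
    have := hpstep k
    have : 0 ≤ t / n := by positivity
    linarith
  have hmem : ∀ k < n, Set.Icc (p k) (p (k + 1)) ⊆ Set.Icc 0 t := fun k hk =>
    Set.Icc_subset_Icc (hp0 ▸ hpmono (Nat.zero_le k)) (hpn ▸ hpmono hk)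
  have hcw : Continuous fun s => g' s * w s := hg'.mul hw
  have hint : ∫ s in (0 : ℝ)..t, g' s * w s =
      ∑ k ∈ Finset.range n, ∫ s in (p k)..(p (k + 1)), g' s * w s := by
    rw [sum_integral_adjacent_intervals fun k _ => hcw.intervalIntegrable _ _, hp0, hpn]
  have htel : g t * w t - g 0 * w 0 =
      ∑ k ∈ Finset.range n, (g (p (k + 1)) * w (p (k + 1)) - g (p k) * w (p k)) := by
    rw [Finset.sum_range_sub (fun k => g (p k) * w (p k)), hp0, hpn]
  -- An exact error formula: on each cell only the oscillation of `w` from its right endpoint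
  -- remains.
  have hdiff : ∑ k ∈ Finset.range n, g (p k) * (w (p (k + 1)) - w (p k)) -
      (g t * w t - g 0 * w 0 - ∫ s in (0 : ℝ)..t, g' s * w s) =
      ∑ k ∈ Finset.range n, ∫ s in (p k)..(p (k + 1)), g' s * (w s - w (p (k + 1))) := by
    rw [hint, htel, ← Finset.sum_sub_distrib, ← Finset.sum_sub_distrib]
    refine Finset.sum_congr rfl fun k _ => ?_
    simp only [mul_sub]
    have hcc : Continuous fun s => g' s * w (p (k + 1)) := hg'.mul continuous_const
    rw [integral_sub (hcw.intervalIntegrable _ _) (hcc.intervalIntegrable _ _),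
      intervalIntegral.integral_mul_const,
      integral_eq_sub_of_hasDerivAt (fun s _ => hg s) (hg'.intervalIntegrable _ _)]
    ring
  rw [Real.dist_eq, hdiff]
  have hbound : ∀ k ∈ Finset.range n,
      |∫ s in (p k)..(p (k + 1)), g' s * (w s - w (p (k + 1)))| ≤
        M * (ε / (M * t + 1)) * (t / n) := by
    intro k hk
    have hk := hmem k (Finset.mem_range.mp hk)
    have hle := hpmono (Nat.le_succ k)
    have h := norm_integral_le_of_norm_le_const (a := p k) (b := p (k + 1))
      (f := fun s => g' s * (w s - w (p (k + 1)))) (C := M * (ε / (M * t + 1))) fun s hs => by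
        rw [Set.uIoc_of_le hle] at hs
        have hs' : s ∈ Set.Icc (p k) (p (k + 1)) := ⟨hs.1.le, hs.2⟩
        rw [norm_mul]
        refine mul_le_mul (hM s (hk hs')) ?_ (norm_nonneg _) hM0
        refine (hwδ s (hk hs') _ (hk ⟨hle, le_rfl⟩) ?_).le
        rw [Real.dist_eq, abs_lt]
        have := hpstep k
        constructor <;> linarith [hs'.1, hs'.2]
    rwa [hpstep, abs_of_nonneg (by positivity : 0 ≤ t / n)] at h
  refine ((Finset.abs_sum_le_sum_abs _ _).trans (Finset.sum_le_sum hbound)).trans_lt ?_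
  rw [Finset.sum_const, Finset.card_range, nsmul_eq_mul]
  have : (n : ℝ) * (M * (ε / (M * t + 1)) * (t / n)) = ε * ((M * t) / (M * t + 1)) := by
    field_simp
  rw [this]
  refine mul_lt_of_lt_one_right hε ?_
  rw [div_lt_one (by positivity)]
  linarith

end RiemannStieltjes

/-! ### Characteristic functions of sums of Wiener increments. -/

section WienerSum

variable {d : ℕ} {Ω : Type*} [MeasurableSpace Ω] {P : Measure Ω}

/-- Frequency `1` loses nothing, because the weights `h` are arbitrary and absorb any scaling. -/
lemma ProbabilityTheory.IsPreBrownianReal.charFun_map_sum_increments {B : ℝ≥0 → Ω → ℝ}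
    (hB : IsPreBrownianReal B P) {τ : ℕ → ℝ≥0} (hτ : Monotone τ) (h : ℕ → ℝ) (n : ℕ) :
    charFun (P.map fun ω => ∑ k ∈ Finset.range n, h k * (B (τ (k + 1)) ω - B (τ k) ω)) 1 =
      Complex.exp (-((∑ k ∈ Finset.range n, h k ^ 2 * (τ (k + 1) - τ k : ℝ) : ℝ) : ℂ) / 2) := by
  have hm := hB.aemeasurable
  have hi : iIndepFun (fun k ω => h k * (B (τ (k + 1)) ω - B (τ k) ω)) P :=
    (hB.hasIndepIncrements.nat hτ).comp (fun k x => h k * x) fun k => by fun_prop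
  rw [(hi.restrict _).charFun_map_fun_finsetSum_eq_prod (fun k _ => by fun_prop),
    Finset.prod_apply]
  have hterm : ∀ k, charFun (P.map fun ω => h k * (B (τ (k + 1)) ω - B (τ k) ω)) 1 =
      Complex.exp (-((h k ^ 2 * (τ (k + 1) - τ k : ℝ) : ℝ) : ℂ) / 2) := by
    intro k
    rw [charFun_map_mul_comp (by fun_prop), mul_one]
    have := (hB.hasLaw_sub (τ (k + 1)) (τ k)).map_eq
    rw [show (fun ω => B (τ (k + 1)) ω - B (τ k) ω) = B (τ (k + 1)) - B (τ k) from rfl, this,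
      charFun_gaussianReal]
    congr 1
    have hle : (τ k : ℝ) ≤ τ (k + 1) := by exact_mod_cast hτ (Nat.le_succ k)
    have hd : ((nndist (τ (k + 1) : ℝ) (τ k : ℝ) : ℝ≥0) : ℝ) = τ (k + 1) - τ k := by
      rw [coe_nndist, Real.dist_eq, abs_of_nonneg (by linarith)]
    have hd' : ((nndist (τ (k + 1) : ℝ) (τ k : ℝ) : ℝ≥0) : ℂ) = ((τ (k + 1) - τ k : ℝ) : ℂ) := by
      rw [← hd]
    erw [hd']
    push_cast
    ring
  simp only [hterm]
  rw [← Complex.exp_sum]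
  congr 1
  push_cast
  rw [← Finset.sum_div, Finset.sum_neg_distrib]

lemma IsWienerProcess.charFun_map_sum_increments
    {W : ℝ≥0 → Ω → EuclideanSpace ℝ (Fin d)} (hW : IsWienerProcess W P) {τ : ℕ → ℝ≥0}
    (hτ : Monotone τ) (h : Fin d → ℕ → ℝ) (n : ℕ) :
    charFun (P.map fun ω => ∑ j, ∑ k ∈ Finset.range n, h j k * (W (τ (k + 1)) ω j - W (τ k) ω j)) 1 =
      Complex.exp
        (-((∑ j, ∑ k ∈ Finset.range n, h j k ^ 2 * (τ (k + 1) - τ k : ℝ) : ℝ) : ℂ) / 2) := by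
  have hm : ∀ j t, AEMeasurable (fun ω => W t ω j) P := fun j t => (hW.coord j).aemeasurable t
  have hi : iIndepFun
      (fun j ω => ∑ k ∈ Finset.range n, h j k * (W (τ (k + 1)) ω j - W (τ k) ω j)) P :=
    -- Independence of whole coordinate paths is inherited by functionals of finitely many of their
    -- values.
    hW.indep.comp
      (fun j x => ∑ k ∈ Finset.range n, h j k * (x (τ (k + 1)) - x (τ k))) fun j => by fun_prop
  rw [hi.charFun_map_fun_sum_eq_prod
    (fun j => Finset.aemeasurable_fun_sum _ fun k _ => by fun_prop), Finset.prod_apply]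
  simp only [(hW.coord _).toIsPreBrownianReal.charFun_map_sum_increments hτ]
  rw [← Complex.exp_sum]
  congr 1
  push_cast
  rw [← Finset.sum_div, Finset.sum_neg_distrib]

lemma IsWienerProcess.ae_continuous {W : ℝ≥0 → Ω → EuclideanSpace ℝ (Fin d)}
    (hW : IsWienerProcess W P) : ∀ᵐ ω ∂P, Continuous fun t => W t ω := by
  filter_upwards [ae_all_iff.mpr fun i => (hW.coord i).cont] with ω hω
  exact (PiLp.continuous_toLp 2 _).comp (continuous_pi hω)

lemma IsWienerProcess.ae_zero {W : ℝ≥0 → Ω → EuclideanSpace ℝ (Fin d)}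
    (hW : IsWienerProcess W P) : ∀ᵐ ω ∂P, W 0 ω = 0 := by
  filter_upwards [ae_all_iff.mpr fun i =>
    (hW.coord i).toIsPreBrownianReal.eval_zero_ae_eq_zero] with ω hω
  ext i
  exact hω i

lemma IsWienerProcess.aemeasurable {W : ℝ≥0 → Ω → EuclideanSpace ℝ (Fin d)}
    (hW : IsWienerProcess W P) (t : ℝ≥0) : AEMeasurable (W t) P :=
  (WithLp.measurable_toLp 2 _).comp_aemeasurable
    (aemeasurable_pi_lambda _ fun i => (hW.coord i).aemeasurable t)

open Filter Topology in
lemma tendsto_charFun_map_of_tendsto_ae [IsFiniteMeasure P] {S : ℕ → Ω → ℝ} {T : Ω → ℝ}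
    (hS : ∀ n, AEMeasurable (S n) P) (hT : AEMeasurable T P)
    (h : ∀ᵐ ω ∂P, Tendsto (fun n => S n ω) atTop (𝓝 (T ω))) (r : ℝ) :
    Tendsto (fun n => charFun (P.map (S n)) r) atTop (𝓝 (charFun (P.map T) r)) := by
  have he : ∀ {X : Ω → ℝ}, AEMeasurable X P →
      charFun (P.map X) r = ∫ ω, Complex.exp (r * X ω * Complex.I) ∂P := fun hX => by
    rw [charFun_apply_real, integral_map hX (by fun_prop)]
  simp only [he (hS _), he hT]
  refine tendsto_integral_of_dominated_convergence (fun _ => 1) (fun n => ?_)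
    (integrable_const 1) (fun n => ?_) ?_
  · have := hS n
    fun_prop
  · refine Eventually.of_forall fun ω => ?_
    rw [← Complex.ofReal_mul, Complex.norm_exp_ofReal_mul_I]
  · filter_upwards [h] with ω hω
    have : Continuous fun x : ℝ => Complex.exp (r * x * Complex.I) := by fun_prop
    exact (this.tendsto _).comp hω

end WienerSum

/-! ### The scalar linear integral equation, path by path. -/

/-- The solution of the scalar integral equation `y t = a + ∫ s in 0..t, μ * y s + n t`. -/
noncomputable def ouPath (μ a : ℝ) (n : ℝ → ℝ) (t : ℝ) : ℝ :=
  a + n t + μ * (Real.exp (μ * t) * ∫ s in (0 : ℝ)..t, Real.exp (-(μ * s)) * (a + n s))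

section ScalarEquation

variable {μ a : ℝ} {n : ℝ → ℝ}

lemma continuous_exp_mul_add (hn : Continuous n) :
    Continuous fun s => Real.exp (-(μ * s)) * (a + n s) := by fun_prop

/-- The noise `n` need not be differentiable, so one works with `Z = ∫ y`, which solves the genuine
ODE `Z' = μ Z + a + n`. -/
lemma hasDerivAt_exp_mul_integral (hn : Continuous n) (t : ℝ) :
    HasDerivAt (fun t => Real.exp (μ * t) * ∫ s in (0 : ℝ)..t, Real.exp (-(μ * s)) * (a + n s))
      (ouPath μ a n t) t := by
  have hc := continuous_exp_mul_add (μ := μ) (a := a) hn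
  have h1 : HasDerivAt (fun t => ∫ s in (0 : ℝ)..t, Real.exp (-(μ * s)) * (a + n s))
      (Real.exp (-(μ * t)) * (a + n t)) t :=
    (hc.integral_hasStrictDerivAt _ _).hasDerivAt
  have h2 : HasDerivAt (fun t => Real.exp (μ * t)) (Real.exp (μ * t) * μ) t := by
    simpa using ((hasDerivAt_id t).const_mul μ).exp
  refine (h2.mul h1).congr_deriv ?_
  have : Real.exp (μ * t) * Real.exp (-(μ * t)) = 1 := by rw [← Real.exp_add]; simp
  rw [ouPath]
  linear_combination (a + n t) * this

lemma continuous_ouPath (hn : Continuous n) : Continuous (ouPath μ a n) := by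
  have h : Continuous fun t =>
      Real.exp (μ * t) * ∫ s in (0 : ℝ)..t, Real.exp (-(μ * s)) * (a + n s) :=
    continuous_iff_continuousAt.mpr fun t => (hasDerivAt_exp_mul_integral hn t).continuousAt
  exact (continuous_const.add hn).add (continuous_const.mul h)

lemma ouPath_eq_integral (hn : Continuous n) (t : ℝ) :
    ouPath μ a n t = a + (∫ s in (0 : ℝ)..t, μ * ouPath μ a n s) + n t := by
  rw [intervalIntegral.integral_const_mul, intervalIntegral.integral_eq_sub_of_hasDerivAt
    (fun s _ => hasDerivAt_exp_mul_integral hn s)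
    ((continuous_ouPath hn).intervalIntegrable _ _), ouPath]
  simp
  ring

/-- Uniqueness: the integrating factor `e^{-μt}` applied to `∫ y` has a derivative free of `y`. -/
lemma eq_ouPath_of_eq_integral {y : ℝ → ℝ} (hy : Continuous y) (hn : Continuous n) {T : ℝ}
    (hT : 0 ≤ T)
    (h : ∀ t, 0 ≤ t → y t = a + (∫ s in (0 : ℝ)..t, μ * y s) + n t) : y T = ouPath μ a n T := by
  have hZ : ∀ t, HasDerivAt (fun t => ∫ s in (0 : ℝ)..t, y s) (y t) t := fun t =>
    (hy.integral_hasStrictDerivAt _ _).hasDerivAt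
  have hder : ∀ t ∈ Set.uIcc 0 T,
      HasDerivAt (fun t => Real.exp (-(μ * t)) * ∫ s in (0 : ℝ)..t, y s)
        (Real.exp (-(μ * t)) * (a + n t)) t := by
    intro t ht
    rw [Set.uIcc_of_le hT] at ht
    have h2 : HasDerivAt (fun t => Real.exp (-(μ * t))) (Real.exp (-(μ * t)) * (-μ)) t := by
      simpa using ((hasDerivAt_id t).const_mul μ).neg.exp
    refine (h2.mul (hZ t)).congr_deriv ?_
    have := h t ht.1
    rw [intervalIntegral.integral_const_mul] at this
    rw [this]
    ring
  have key := intervalIntegral.integral_eq_sub_of_hasDerivAt hder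
    ((continuous_exp_mul_add hn).intervalIntegrable _ _)
  have hexp : Real.exp (μ * T) * Real.exp (-(μ * T)) = 1 := by rw [← Real.exp_add]; simp
  rw [h T hT, intervalIntegral.integral_const_mul, ouPath, key, intervalIntegral.integral_same]
  linear_combination (-μ * ∫ s in (0 : ℝ)..T, y s) * hexp

lemma integral_exp_neg_mul (μ t : ℝ) :
    μ * ∫ s in (0 : ℝ)..t, Real.exp (-(μ * s)) = 1 - Real.exp (-(μ * t)) := by
  have h : ∀ s ∈ Set.uIcc 0 t,
      HasDerivAt (fun s => -Real.exp (-(μ * s))) (μ * Real.exp (-(μ * s))) s := by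
    intro s _
    have := (((hasDerivAt_id s).const_mul μ).neg.exp).neg
    refine this.congr_deriv ?_
    simp
    ring
  rw [← intervalIntegral.integral_const_mul, intervalIntegral.integral_eq_sub_of_hasDerivAt h
    (Continuous.intervalIntegrable (by fun_prop) _ _)]
  simp
  ring

lemma expQuot_eq_integral (t c : ℝ) :
    expQuot t c = ∫ s in (0 : ℝ)..t, Real.exp (-(c * s)) := by
  rw [expQuot]
  split_ifs with h
  · simp [h]
  · rw [← integral_exp_neg_mul, mul_div_cancel_left₀ _ h]

lemma expQuot_nonneg {t : ℝ} (ht : 0 ≤ t) (c : ℝ) : 0 ≤ expQuot t c := by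
  rw [expQuot_eq_integral]
  exact intervalIntegral.integral_nonneg ht fun s _ => (Real.exp_pos _).le

open Filter Topology

lemma hasDerivAt_exp_mul_sub (μ t s : ℝ) :
    HasDerivAt (fun s => Real.exp (μ * (t - s))) (-μ * Real.exp (μ * (t - s))) s := by
  have := (((hasDerivAt_id s).const_sub t).const_mul μ).exp
  refine this.congr_deriv ?_
  simp
  ring

/-- The limit is the stochastic convolution, that is, `ouPath` without the contribution `e^{μt} a`
of the initial value. -/
lemma tendsto_sum_exp_mul_sub (μ a : ℝ) (hn : Continuous n) (hn0 : n 0 = 0) {t : ℝ} (ht : 0 ≤ t) :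
    Tendsto (fun N : ℕ => ∑ k ∈ Finset.range N,
        Real.exp (μ * (t - t * k / N)) * (n (t * (k + 1 : ℕ) / N) - n (t * k / N))) atTop
      (𝓝 (ouPath μ a n t - Real.exp (μ * t) * a)) := by
  have h := tendsto_sum_mul_sub_of_hasDerivAt ht (hasDerivAt_exp_mul_sub μ t) (by fun_prop) hn
  have heq : (∫ s in (0 : ℝ)..t, -μ * Real.exp (μ * (t - s)) * n s) =
      -μ * (Real.exp (μ * t) * ∫ s in (0 : ℝ)..t, Real.exp (-(μ * s)) * n s) := by
    rw [← intervalIntegral.integral_const_mul, ← intervalIntegral.integral_const_mul]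
    refine intervalIntegral.integral_congr fun s _ => ?_
    have : Real.exp (μ * (t - s)) = Real.exp (μ * t) * Real.exp (-(μ * s)) := by
      rw [← Real.exp_add]; ring_nf
    simp only [this]
    ring
  have hsplit : (∫ s in (0 : ℝ)..t, Real.exp (-(μ * s)) * (a + n s)) =
      (∫ s in (0 : ℝ)..t, Real.exp (-(μ * s))) * a +
        ∫ s in (0 : ℝ)..t, Real.exp (-(μ * s)) * n s := by
    simp only [mul_add]
    rw [intervalIntegral.integral_add (Continuous.intervalIntegrable (by fun_prop) _ _)
      (Continuous.intervalIntegrable (by fun_prop) _ _), intervalIntegral.integral_mul_const]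
  have hexp : Real.exp (μ * t) * Real.exp (-(μ * t)) = 1 := by rw [← Real.exp_add]; simp
  have hI := integral_exp_neg_mul μ t
  convert h using 2
  rw [heq, hn0, ouPath, hsplit]
  simp only [sub_self, mul_zero, Real.exp_zero, one_mul, sub_zero]
  linear_combination (Real.exp (μ * t) * a) * hI - a * hexp

/-- This is the previous convergence for the path `n(s) = s` and rate `2μ`; the limit is identified
by uniqueness, since `E(s) = ∫₀ˢ e^{2μr} dr` satisfies `E' = 2μE + 1`. -/
lemma tendsto_sum_exp_sq_mul_sub (μ : ℝ) {t : ℝ} (ht : 0 ≤ t) :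
    Tendsto (fun N : ℕ => ∑ k ∈ Finset.range N,
        Real.exp (μ * (t - t * k / N)) ^ 2 * (t * (k + 1 : ℕ) / N - t * k / N)) atTop
      (𝓝 (expQuot t (-(2 * μ)))) := by
  have h := tendsto_sum_exp_mul_sub (2 * μ) 0 continuous_id rfl ht
  have hsq : ∀ x : ℝ, Real.exp (μ * x) ^ 2 = Real.exp (2 * μ * x) := fun x => by
    rw [← Real.exp_nat_mul]; push_cast; ring_nf
  simp only [hsq]
  suffices hE : ouPath (2 * μ) 0 id t = expQuot t (-(2 * μ)) by
    rw [mul_zero, sub_zero, hE] at h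
    exact h
  set E : ℝ → ℝ := fun s => ∫ r in (0 : ℝ)..s, Real.exp (2 * μ * r) with hE
  have hEc : Continuous E := continuous_iff_continuousAt.mpr fun s =>
    have hc : Continuous fun r => Real.exp (2 * μ * r) := by fun_prop
    (hc.integral_hasStrictDerivAt _ _).hasDerivAt.continuousAt
  have hE' : ∀ s, E s = 0 + (∫ r in (0 : ℝ)..s, 2 * μ * E r) + id s := by
    intro s
    have h1 : ∀ r, 2 * μ * E r = Real.exp (2 * μ * r) - 1 := by
      intro r
      have := integral_exp_neg_mul (-(2 * μ)) r
      simp only [neg_mul, neg_neg] at this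
      simp only [hE]
      linarith
    simp only [h1]
    rw [intervalIntegral.integral_sub (Continuous.intervalIntegrable (by fun_prop) _ _)
      (Continuous.intervalIntegrable (by fun_prop) _ _)]
    simp [hE]
  rw [← eq_ouPath_of_eq_integral hEc continuous_id ht fun s _ => hE' s, expQuot_eq_integral]
  simp [hE]

end ScalarEquation

/-! ### Linear SDEs in eigencoordinates. -/

section LinearSDE

open Filter Topology Matrix

variable {d : ℕ} {Ω : Type*}

/-- The `i`-th coordinate of `Q W` along `ω`, extended by a constant to negative times. -/
noncomputable def noisePath (Q : Matrix (Fin d) (Fin d) ℝ)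
    (W : ℝ≥0 → Ω → EuclideanSpace ℝ (Fin d)) (ω : Ω) (i : Fin d) (s : ℝ) : ℝ :=
  toEuclideanCLM (𝕜 := ℝ) Q (W s.toNNReal ω) i

lemma continuous_noisePath {Q : Matrix (Fin d) (Fin d) ℝ}
    {W : ℝ≥0 → Ω → EuclideanSpace ℝ (Fin d)} {ω : Ω} (h : Continuous fun t => W t ω) (i : Fin d) :
    Continuous (noisePath Q W ω i) := by
  unfold noisePath
  have := h.comp continuous_real_toNNReal
  fun_prop

lemma noisePath_zero {Q : Matrix (Fin d) (Fin d) ℝ}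
    {W : ℝ≥0 → Ω → EuclideanSpace ℝ (Fin d)} {ω : Ω} (h : W 0 ω = 0) (i : Fin d) :
    noisePath Q W ω i 0 = 0 := by
  simp [noisePath, h]

lemma tendsto_sum_exp_mul_noisePath {Q : Matrix (Fin d) (Fin d) ℝ}
    {W : ℝ≥0 → Ω → EuclideanSpace ℝ (Fin d)} {ω : Ω} (h : Continuous fun t => W t ω)
    (h0 : W 0 ω = 0) (i : Fin d) (μ a : ℝ) (t : ℝ≥0) :
    Tendsto (fun N : ℕ => ∑ k ∈ Finset.range N, Real.exp (μ * (t - t * k / N)) *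
        (toEuclideanCLM (𝕜 := ℝ) Q (W (t * (k + 1 : ℕ) / N) ω) i -
          toEuclideanCLM (𝕜 := ℝ) Q (W (t * k / N) ω) i)) atTop
      (𝓝 (ouPath μ a (noisePath Q W ω i) t - Real.exp (μ * t) * a)) := by
  have hlim := tendsto_sum_exp_mul_sub μ a (continuous_noisePath (Q := Q) h i)
    (noisePath_zero h0 i) t.2
  have hnode : ∀ k N : ℕ, Real.toNNReal (t * k / N) = t * k / N := fun k N => by
    rw [← Real.toNNReal_coe (r := t * k / N)]; push_cast; rfl
  simpa only [noisePath, NNReal.val_eq_coe, hnode] using hlim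

/-- The rows of `Q` are orthogonal with squared length `c`. This removes the cross terms between
eigencoordinates from the variance. -/
lemma sum_sq_sum_mul {Q : Matrix (Fin d) (Fin d) ℝ} {c : ℝ}
    (hQ : Q * Qᵀ = c • (1 : Matrix (Fin d) (Fin d) ℝ)) (z : Fin d → ℝ) :
    ∑ j, (∑ i, z i * Q i j) ^ 2 = c * ∑ i, z i ^ 2 := by
  have h : (z ᵥ* Q) ⬝ᵥ (z ᵥ* Q) = z ⬝ᵥ (c • z) := by
    rw [← mulVec_transpose Q z, dotProduct_mulVec, vecMul_mulVec, transpose_transpose, hQ,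
      dotProduct_comm, vecMul_smul, vecMul_one]
  simpa [dotProduct, vecMul, sq, Finset.mul_sum, mul_left_comm] using h

lemma integral_toEuclideanCLM_apply {y : ℝ → EuclideanSpace ℝ (Fin d)} (hy : Continuous y)
    (L : Matrix (Fin d) (Fin d) ℝ) (t : ℝ) (i : Fin d) :
    toEuclideanCLM (𝕜 := ℝ) L (∫ s in (0 : ℝ)..t, y s) i =
      ∫ s in (0 : ℝ)..t, toEuclideanCLM (𝕜 := ℝ) L (y s) i :=
  (((EuclideanSpace.proj (𝕜 := ℝ) i).comp
    (toEuclideanCLM (𝕜 := ℝ) L)).intervalIntegral_comp_comm (hy.intervalIntegrable 0 t)).symm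

lemma eq_iff_toEuclideanCLM_transpose_apply_eq {U : Matrix (Fin d) (Fin d) ℝ} (hU : Uᵀ * U = 1)
    {x y : EuclideanSpace ℝ (Fin d)} :
    x = y ↔ ∀ i, toEuclideanCLM (𝕜 := ℝ) Uᵀ x i = toEuclideanCLM (𝕜 := ℝ) Uᵀ y i := by
  refine ⟨fun h i => by rw [h], fun h => ?_⟩
  rw [← toEuclideanCLM_transpose_cancel hU x, ← toEuclideanCLM_transpose_cancel hU y]
  congr 1
  ext i
  exact h i

/-- Only the drift decouples under `Uᵀ`: each scalar noise may still involve all coordinates of `W`.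
-/
lemma linear_integral_eq_iff {U D : Matrix (Fin d) (Fin d) ℝ} (hU : Uᵀ * U = 1) (μ : Fin d → ℝ)
    (x₀ : EuclideanSpace ℝ (Fin d)) {W X : ℝ≥0 → Ω → EuclideanSpace ℝ (Fin d)} {ω : Ω}
    (hX : Continuous fun t => X t ω) (t : ℝ≥0) :
    X t ω = x₀ + (∫ s in (0 : ℝ)..t,
        toEuclideanCLM (𝕜 := ℝ) (U * diagonal μ * Uᵀ) (X s.toNNReal ω)) +
          toEuclideanCLM (𝕜 := ℝ) D (W t ω) ↔
      ∀ i, toEuclideanCLM (𝕜 := ℝ) Uᵀ (X t ω) i = toEuclideanCLM (𝕜 := ℝ) Uᵀ x₀ i +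
        (∫ s in (0 : ℝ)..t, μ i * toEuclideanCLM (𝕜 := ℝ) Uᵀ (X s.toNNReal ω) i) +
          noisePath (Uᵀ * D) W ω i t := by
  have hXc : Continuous fun s : ℝ => X s.toNNReal ω := hX.comp continuous_real_toNNReal
  rw [eq_iff_toEuclideanCLM_transpose_apply_eq hU]
  refine forall_congr' fun i => ?_
  rw [map_add, map_add, PiLp.add_apply, PiLp.add_apply,
    integral_toEuclideanCLM_apply (by fun_prop)]
  simp only [conj_diagonal_apply hU, noisePath, Real.toNNReal_coe, toEuclideanCLM_mul_apply Uᵀ D]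

variable [MeasurableSpace Ω] {P : Measure Ω}

/-- `ouPath` integrates over a whole path; measurability comes from the approximating sums, which
use finitely many values of `W`. -/
lemma aemeasurable_ouPath_noisePath {W : ℝ≥0 → Ω → EuclideanSpace ℝ (Fin d)}
    (hW : IsWienerProcess W P) (Q : Matrix (Fin d) (Fin d) ℝ) (i : Fin d) (μ a : ℝ) (t : ℝ≥0) :
    AEMeasurable (fun ω => ouPath μ a (noisePath Q W ω i) t) P := by
  have hm := hW.aemeasurable
  have h : AEMeasurable
      (fun ω => ouPath μ a (noisePath Q W ω i) t - Real.exp (μ * t) * a) P := by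
    refine aemeasurable_of_tendsto_metrizable_ae' (f := fun (N : ℕ) ω =>
      ∑ k ∈ Finset.range N, Real.exp (μ * (t - t * k / N)) *
        (toEuclideanCLM (𝕜 := ℝ) Q (W (t * (k + 1 : ℕ) / N) ω) i -
          toEuclideanCLM (𝕜 := ℝ) Q (W (t * k / N) ω) i)) (fun N => ?_) ?_
    · exact Finset.aemeasurable_fun_sum _ fun k _ => by fun_prop
    · filter_upwards [hW.ae_continuous, hW.ae_zero] with ω h h0
      exact tendsto_sum_exp_mul_noisePath h h0 i μ a t
  simpa using h.add_const (Real.exp (μ * t) * a)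

lemma hasLaw_of_ae_eq_ouPath [IsProbabilityMeasure P] {U D : Matrix (Fin d) (Fin d) ℝ}
    (hU : Uᵀ * U = 1) {c : ℝ} (hc : 0 ≤ c) (hD : D * Dᵀ = c • (1 : Matrix (Fin d) (Fin d) ℝ))
    {W : ℝ≥0 → Ω → EuclideanSpace ℝ (Fin d)} (hW : IsWienerProcess W P) (μ : Fin d → ℝ)
    (x₀ : EuclideanSpace ℝ (Fin d)) (t : ℝ≥0) {Y : Ω → EuclideanSpace ℝ (Fin d)}
    (hY : AEMeasurable Y P)
    (h : ∀ᵐ ω ∂P, ∀ i, toEuclideanCLM (𝕜 := ℝ) Uᵀ (Y ω) i =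
      ouPath (μ i) (toEuclideanCLM (𝕜 := ℝ) Uᵀ x₀ i) (noisePath (Uᵀ * D) W ω i) t) :
    HasLaw Y (multivariateGaussian
      (toEuclideanCLM (𝕜 := ℝ) (U * diagonal (fun i => Real.exp (μ i * t)) * Uᵀ) x₀)
      (U * diagonal (fun i => c * expQuot t (-(2 * μ i))) * Uᵀ)) P := by
  refine hasLaw_multivariateGaussian_of_charFun hY
    (fun i => mul_nonneg hc (expQuot_nonneg t.2 _)) fun u => ?_
  set v := toEuclideanCLM (𝕜 := ℝ) Uᵀ u with hv
  set m := toEuclideanCLM (𝕜 := ℝ) (U * diagonal (fun i => Real.exp (μ i * t)) * Uᵀ) x₀ with hm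
  set Q := Uᵀ * D with hQdef
  have hQ : Q * Qᵀ = c • (1 : Matrix (Fin d) (Fin d) ℝ) := by
    rw [hQdef, transpose_mul, transpose_transpose, Matrix.mul_assoc, ← Matrix.mul_assoc D, hD,
      Matrix.smul_mul, Matrix.one_mul, Matrix.mul_smul, hU]
  have hinner : ∀ y, inner ℝ y u = ∑ i, v i * toEuclideanCLM (𝕜 := ℝ) Uᵀ y i := by
    intro y
    rw [← toEuclideanCLM_transpose_cancel hU y, inner_toEuclideanCLM_left,
      toEuclideanCLM_transpose_cancel hU, PiLp.inner_apply]
    rfl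
  have hWm := hW.aemeasurable
  set τ : ℕ → ℕ → ℝ≥0 := fun N k => t * k / N with hτ
  have hτmono : ∀ N, Monotone (τ N) := fun N k l hkl => by
    simp only [hτ]
    gcongr
  -- Weights regrouped by coordinate `j` of `W` instead of eigencoordinate `i`, since it is the
  -- former that are independent.
  set H : ℕ → Fin d → ℕ → ℝ := fun N j k =>
    ∑ i, v i * Real.exp (μ i * (t - t * k / N)) * Q i j with hH
  set S : ℕ → Ω → ℝ := fun N ω => ∑ j, ∑ k ∈ Finset.range N,
    H N j k * (W (τ N (k + 1)) ω j - W (τ N k) ω j) with hS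
  have hSm : ∀ N, AEMeasurable (S N) P := fun N =>
    Finset.aemeasurable_fun_sum _ fun j _ => Finset.aemeasurable_fun_sum _ fun k _ => by fun_prop
  -- The centred projection on `u`; its characteristic function at `1` determines that of `Y` at
  -- `u`.
  set T : Ω → ℝ := fun ω => inner ℝ (Y ω) u - inner ℝ m u with hT
  have hTm : AEMeasurable T P := by fun_prop
  have hST : ∀ N ω, S N ω = ∑ i, v i * ∑ k ∈ Finset.range N, Real.exp (μ i * (t - t * k / N)) *
        (toEuclideanCLM (𝕜 := ℝ) Q (W (t * (k + 1 : ℕ) / N) ω) i -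
          toEuclideanCLM (𝕜 := ℝ) Q (W (t * k / N) ω) i) := by
    intro N ω
    simp only [hS, hH, hτ, ofLp_toEuclideanCLM, mulVec, dotProduct, ← Finset.sum_sub_distrib,
      Finset.mul_sum, Finset.sum_mul]
    rw [Finset.sum_comm]
    simp only [Finset.sum_comm (s := (Finset.univ : Finset (Fin d))) (t := Finset.range N)]
    refine Finset.sum_congr rfl fun k _ => ?_
    rw [Finset.sum_comm]
    refine Finset.sum_congr rfl fun i _ => Finset.sum_congr rfl fun j _ => ?_
    ring
  have hlim : ∀ᵐ ω ∂P, Tendsto (fun N => S N ω) atTop (𝓝 (T ω)) := by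
    filter_upwards [hW.ae_continuous, hW.ae_zero, h] with ω hcont h0 hYω
    simp only [hST, hT, hinner, ← Finset.sum_sub_distrib, ← mul_sub]
    refine tendsto_finsetSum _ fun i _ => Tendsto.const_mul _ ?_
    rw [hYω i, hm, conj_diagonal_apply hU]
    exact tendsto_sum_exp_mul_noisePath hcont h0 i _ _ t
  have hvar : ∀ N : ℕ, ∑ j, ∑ k ∈ Finset.range N, H N j k ^ 2 * (τ N (k + 1) - τ N k : ℝ) =
      ∑ i, c * v i ^ 2 * ∑ k ∈ Finset.range N,
        Real.exp (μ i * (t - t * k / N)) ^ 2 * (t * (k + 1 : ℕ) / N - t * k / N) := by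
    intro N
    rw [Finset.sum_comm]
    simp only [← Finset.sum_mul, hH, sum_sq_sum_mul hQ, Finset.mul_sum, hτ]
    rw [Finset.sum_comm]
    refine Finset.sum_congr rfl fun k _ => ?_
    rw [Finset.sum_mul]
    refine Finset.sum_congr rfl fun i _ => ?_
    push_cast
    ring
  have hvlim : Tendsto
      (fun N : ℕ => ∑ j, ∑ k ∈ Finset.range N, H N j k ^ 2 * (τ N (k + 1) - τ N k : ℝ)) atTop
      (𝓝 (∑ i, c * expQuot t (-(2 * μ i)) * v i ^ 2)) := by
    simp only [hvar]
    refine tendsto_finsetSum _ fun i _ => ?_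
    rw [mul_right_comm]
    exact (tendsto_sum_exp_sq_mul_sub (μ i) t.2).const_mul _
  have hchar : charFun (P.map T) 1 =
      Complex.exp (-((∑ i, c * expQuot t (-(2 * μ i)) * v i ^ 2 : ℝ) : ℂ) / 2) := by
    refine tendsto_nhds_unique (tendsto_charFun_map_of_tendsto_ae hSm hTm hlim 1) ?_
    simp only [hS, hW.charFun_map_sum_increments (hτmono _)]
    have hc : Continuous fun x : ℝ => Complex.exp (-(x : ℂ) / 2) := by fun_prop
    exact (hc.tendsto _).comp hvlim
  have hYT : charFun (P.map Y) u =
      Complex.exp ((inner ℝ u m : ℝ) * Complex.I) * charFun (P.map T) 1 := by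
    rw [charFun_apply, charFun_apply_real, integral_map hY (by fun_prop),
      integral_map hTm (by fun_prop), ← integral_const_mul]
    refine integral_congr_ae (Eventually.of_forall fun ω => ?_)
    simp only [hT, real_inner_comm u m]
    rw [← Complex.exp_add]
    congr 1
    push_cast
    ring
  rw [hYT, hchar, ← Complex.exp_add]
  congr 1
  ring

theorem linearSDE_exists_and_hasLaw [IsProbabilityMeasure P] {U D : Matrix (Fin d) (Fin d) ℝ}
    (hU : Uᵀ * U = 1) {c : ℝ} (hc : 0 ≤ c) (hD : D * Dᵀ = c • (1 : Matrix (Fin d) (Fin d) ℝ))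
    {W : ℝ≥0 → Ω → EuclideanSpace ℝ (Fin d)} (hW : IsWienerProcess W P) (μ : Fin d → ℝ)
    (x₀ : EuclideanSpace ℝ (Fin d)) {b : EuclideanSpace ℝ (Fin d) → EuclideanSpace ℝ (Fin d)}
    (hb : ∀ x, b x = toEuclideanCLM (𝕜 := ℝ) (U * diagonal μ * Uᵀ) x) :
    (∃ X, IsSDESolution b D x₀ W X P) ∧
      ∀ X, IsSDESolution b D x₀ W X P → ∀ t : ℝ≥0, HasLaw (X t) (multivariateGaussian
        (toEuclideanCLM (𝕜 := ℝ) (U * diagonal (fun i => Real.exp (μ i * t)) * Uᵀ) x₀)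
        (c • (U * diagonal (fun i => expQuot t (-(2 * μ i))) * Uᵀ))) P := by
  obtain rfl : b = fun x => toEuclideanCLM (𝕜 := ℝ) (U * diagonal μ * Uᵀ) x := funext hb
  refine ⟨?_, fun X hX t => ?_⟩
  · set X : ℝ≥0 → Ω → EuclideanSpace ℝ (Fin d) := fun t ω =>
      toEuclideanCLM (𝕜 := ℝ) U (WithLp.toLp 2 fun i =>
        ouPath (μ i) (toEuclideanCLM (𝕜 := ℝ) Uᵀ x₀ i) (noisePath (Uᵀ * D) W ω i) t) with hX
    have hXi : ∀ t ω i, toEuclideanCLM (𝕜 := ℝ) Uᵀ (X t ω) i =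
        ouPath (μ i) (toEuclideanCLM (𝕜 := ℝ) Uᵀ x₀ i) (noisePath (Uᵀ * D) W ω i) t := by
      intro t ω i
      rw [hX, toEuclideanCLM_transpose_cancel' hU]
    have hXcont : ∀ ω, (Continuous fun t => W t ω) → Continuous fun t => X t ω := by
      intro ω h
      refine (toEuclideanCLM (𝕜 := ℝ) U).continuous.comp
        ((PiLp.continuous_toLp 2 _).comp (continuous_pi fun i => ?_))
      exact (continuous_ouPath (continuous_noisePath h i)).comp NNReal.continuous_coe
    refine ⟨X, fun t => ?_, ?_, ?_⟩
    · refine (toEuclideanCLM (𝕜 := ℝ) U).continuous.measurable.comp_aemeasurable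
        ((WithLp.measurable_toLp 2 _).comp_aemeasurable (aemeasurable_pi_lambda _ fun i => ?_))
      exact aemeasurable_ouPath_noisePath hW _ _ _ _ _
    · filter_upwards [hW.ae_continuous] with ω h using hXcont ω h
    · filter_upwards [hW.ae_continuous] with ω h t
      rw [linear_integral_eq_iff hU μ x₀ (hXcont ω h)]
      intro i
      simp only [hXi]
      rw [ouPath_eq_integral (continuous_noisePath h i)]
      congr 2
      -- The extension to negative times is invisible, as `s` ranges over `[0, t]`.
      refine intervalIntegral.integral_congr fun s hs => ?_
      rw [Set.uIcc_of_le t.coe_nonneg] at hs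
      simp only [Real.coe_toNNReal s hs.1]
  · rw [smul_conj_diagonal]
    refine hasLaw_of_ae_eq_ouPath hU hc hD hW μ x₀ t (hX.aemeasurable t) ?_
    filter_upwards [hW.ae_continuous, hX.continuous_paths, hX.integral_eq] with ω hWω hXω hint i
    have hy : Continuous fun s : ℝ => toEuclideanCLM (𝕜 := ℝ) Uᵀ (X s.toNNReal ω) i := by
      have := hXω.comp continuous_real_toNNReal
      fun_prop
    have := eq_ouPath_of_eq_integral (μ := μ i) (a := toEuclideanCLM (𝕜 := ℝ) Uᵀ x₀ i) hy
      (continuous_noisePath (Q := Uᵀ * D) hWω i) t.2 fun s hs => by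
        have := (linear_integral_eq_iff hU μ x₀ hXω s.toNNReal).mp (hint _) i
        rwa [Real.coe_toNNReal s hs] at this
    simpa using this

end LinearSDE

/-! ### Scalar identities for SPF, and the assembly. -/

lemma logQuot_mul_mul {η : ℝ} (hη : 0 < η) (l : ℝ) :
    logQuot (η * l) * l = Real.log (1 - η * l) / η := by
  rw [logQuot]
  split_ifs with h
  · have hl : l = 0 := (mul_eq_zero.mp h).resolve_left hη.ne'
    simp [hl]
  · have hl : l ≠ 0 := right_ne_zero_of_mul h
    field_simp

/-- Positivity of `1 - ηl` turns the real power into an exponential of rate `2 log(1 - ηl)/η`; the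
two conventions at zero correspond. -/
lemma mul_powQuot_div {η : ℝ} (hη : 0 < η) {l : ℝ} (hl : η * l < 1) (t : ℝ) :
    η * powQuot (t / η) (η * l) = expQuot t (-(2 * (Real.log (1 - η * l) / η))) := by
  have hpos : 0 < 1 - η * l := by linarith
  by_cases h : η * l = 0
  · simp only [powQuot, expQuot, h, if_true, sub_zero, Real.log_one, zero_div, mul_zero, neg_zero]
    field_simp
  · have hlog : Real.log (1 - η * l) ≠ 0 :=
      Real.log_ne_zero_of_pos_of_ne_one hpos fun h1 => h (by linarith)
    have hne : -(2 * (Real.log (1 - η * l) / η)) ≠ 0 :=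
      neg_ne_zero.mpr (mul_ne_zero two_ne_zero (div_ne_zero hlog hη.ne'))
    rw [powQuot, expQuot, if_neg h, if_neg hne, Real.rpow_def_of_pos hpos]
    have : Real.log (1 - η * l) * (2 * (t / η)) =
        -(-(2 * (Real.log (1 - η * l) / η)) * t) := by ring
    rw [this]
    field_simp

theorem mainTheorem11 {d : ℕ} (A U : Matrix (Fin d) (Fin d) ℝ) (lam : Fin d → ℝ)
    (hA : A.IsSymm) (hU : U.transpose * U = 1)
    (hdecomp : A = U * Matrix.diagonal lam * U.transpose)
    (η σ : ℝ) (hη : 0 < η) (x₀ : EuclideanSpace ℝ (Fin d))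
    {Ω : Type*} [MeasurableSpace Ω] (P : Measure Ω) [IsProbabilityMeasure P] :
    -- SGD
    (∀ (F : EuclideanSpace ℝ (Fin d) → EuclideanSpace ℝ (Fin d) → ℝ)
        (ξ : ℕ → Ω → EuclideanSpace ℝ (Fin d)),
      HasAdditiveNoise F (quadObjective A) →
      iIndepFun ξ P →
      (∀ k, HasLaw (ξ k) (multivariateGaussian 0 (σ ^ 2 • (1 : Matrix (Fin d) (Fin d) ℝ))) P) →
      ∀ k : ℕ,
        HasLaw (sgdIterate (fun _ => η) F ξ x₀ k)
          (multivariateGaussian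
            (Matrix.toEuclideanCLM (𝕜 := ℝ)
              (U * (1 - η • Matrix.diagonal lam) ^ k * U.transpose) x₀)
            ((η ^ 2 * σ ^ 2) •
              ∑ m ∈ Finset.range k,
                U * (1 - η • Matrix.diagonal lam) ^ (2 * m) * U.transpose)) P) ∧
    -- SME-1
    (∀ (D : Matrix (Fin d) (Fin d) ℝ) (W : ℝ≥0 → Ω → EuclideanSpace ℝ (Fin d)),
      IsMatrixSqrt D (η • σ ^ 2 • (1 : Matrix (Fin d) (Fin d) ℝ)) →
      IsWienerProcess W P →
      (∃ X, IsSDESolution (sme1Drift (quadObjective A)) D x₀ W X P) ∧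
      ∀ X, IsSDESolution (sme1Drift (quadObjective A)) D x₀ W X P → ∀ t : ℝ≥0,
        HasLaw (X t)
          (multivariateGaussian
            (Matrix.toEuclideanCLM (𝕜 := ℝ) (NormedSpace.exp (-((t : ℝ) • A))) x₀)
            ((η * σ ^ 2) •
              (U * Matrix.diagonal (fun i => expQuot t (2 * lam i)) * U.transpose))) P) ∧
    -- SME-2
    (∀ (D : Matrix (Fin d) (Fin d) ℝ) (W : ℝ≥0 → Ω → EuclideanSpace ℝ (Fin d)),
      IsMatrixSqrt D (η • σ ^ 2 • (1 : Matrix (Fin d) (Fin d) ℝ)) →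
      IsWienerProcess W P →
      (∃ X, IsSDESolution (sme2Drift η (quadObjective A)) D x₀ W X P) ∧
      ∀ X, IsSDESolution (sme2Drift η (quadObjective A)) D x₀ W X P → ∀ t : ℝ≥0,
        HasLaw (X t)
          (multivariateGaussian
            (Matrix.toEuclideanCLM (𝕜 := ℝ)
              (NormedSpace.exp (-((t : ℝ) • (A + (η / 2) • A ^ 2)))) x₀)
            ((η * σ ^ 2) •
              (U * Matrix.diagonal (fun i => expQuot t (2 * lam i + η * lam i ^ 2)) *
                U.transpose))) P) ∧
    -- SPF
    (η * ‖Matrix.toEuclideanCLM (𝕜 := ℝ) A‖ < 1 →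
      ∀ (D : Matrix (Fin d) (Fin d) ℝ) (W : ℝ≥0 → Ω → EuclideanSpace ℝ (Fin d)),
      IsMatrixSqrt D (η • σ ^ 2 • (1 : Matrix (Fin d) (Fin d) ℝ)) →
      IsWienerProcess W P →
      (∃ X, IsSDESolution (spfDrift η (quadObjective A)) D x₀ W X P) ∧
      ∀ X, IsSDESolution (spfDrift η (quadObjective A)) D x₀ W X P → ∀ t : ℝ≥0,
        HasLaw (X t)
          (multivariateGaussian
            (Matrix.toEuclideanCLM (𝕜 := ℝ)
              (U * Matrix.diagonal (fun i => (1 - η * lam i) ^ ((t : ℝ) / η)) * U.transpose) x₀)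
            ((η ^ 2 * σ ^ 2) •
              (U * Matrix.diagonal (fun i => powQuot (t / η) (η * lam i)) *
                U.transpose))) P) := by
  have hAsymm : (A + (η / 2) • A ^ 2).IsSymm := by
    simp [Matrix.IsSymm, Matrix.transpose_pow, hA.eq]
  have hA2 : A + (η / 2) • A ^ 2 =
      U * Matrix.diagonal (fun i => lam i + η / 2 * lam i ^ 2) * U.transpose := by
    rw [hdecomp, Matrix.conj_diagonal_pow hU, Matrix.smul_conj_diagonal, Matrix.conj_diagonal_add]
  have hc : 0 ≤ η * σ ^ 2 := by positivity
  have hexp : ∀ (t : ℝ) (a : Fin d → ℝ),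
      NormedSpace.exp (-(t • (U * Matrix.diagonal a * U.transpose))) =
        U * Matrix.diagonal (fun i => Real.exp (-a i * t)) * U.transpose := by
    intro t a
    rw [← neg_smul, Matrix.smul_conj_diagonal, Matrix.exp_conj_diagonal hU]
    simp only [mul_comm, mul_neg]
  have hsqrt : ∀ {D : Matrix (Fin d) (Fin d) ℝ},
      IsMatrixSqrt D (η • σ ^ 2 • (1 : Matrix (Fin d) (Fin d) ℝ)) →
        D * D.transpose = (η * σ ^ 2) • (1 : Matrix (Fin d) (Fin d) ℝ) := fun hD => by
    rw [IsMatrixSqrt] at hD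
    rw [hD, smul_smul]
  refine ⟨fun F ξ hF hind hξ k => hasLaw_sgdIterate hU hdecomp η σ hF hind hξ x₀ k,
    fun D W hD hW => ?_, fun D W hD hW => ?_, fun hnorm D W hD hW => ?_⟩
  · have hb : ∀ x, sme1Drift (quadObjective A) x = Matrix.toEuclideanCLM (𝕜 := ℝ)
        (U * Matrix.diagonal (fun i => -lam i) * U.transpose) x := by
      intro x
      rw [sme1Drift, gradient_quadObjective hA, hdecomp]
      have := Matrix.smul_conj_diagonal (U := U) (-1) lam
      simp only [neg_one_smul, neg_one_mul] at this
      rw [← this, map_neg]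
      rfl
    obtain ⟨h1, h2⟩ := linearSDE_exists_and_hasLaw hU hc (hsqrt hD) hW _ x₀ hb
    refine ⟨h1, fun X hX t => ?_⟩
    have h3 := h2 X hX t
    rw [hdecomp, hexp]
    simpa only [mul_neg, neg_neg] using h3
  · have hb : ∀ x, sme2Drift η (quadObjective A) x = Matrix.toEuclideanCLM (𝕜 := ℝ)
        (U * Matrix.diagonal (fun i => -(lam i + η / 2 * lam i ^ 2)) * U.transpose) x := by
      intro x
      rw [sme2Drift, quadObjective_add_norm_sq_gradient hA, gradient_quadObjective hAsymm, hA2]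
      have := Matrix.smul_conj_diagonal (U := U) (-1) fun i => lam i + η / 2 * lam i ^ 2
      simp only [neg_one_smul, neg_one_mul] at this
      rw [← this, map_neg]
      rfl
    obtain ⟨h1, h2⟩ := linearSDE_exists_and_hasLaw hU hc (hsqrt hD) hW _ x₀ hb
    refine ⟨h1, fun X hX t => ?_⟩
    have h3 := h2 X hX t
    have hvar : ∀ i, -(2 * -(lam i + η / 2 * lam i ^ 2)) = 2 * lam i + η * lam i ^ 2 :=
      fun i => by ring
    rw [hA2, hexp]
    simpa only [hvar] using h3
  -- The norm bound enters only here: eigenvalues are at most `‖A‖`, so every `1 - ηλᵢ` is positive.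
  · have hl : ∀ i, η * lam i < 1 := fun i => by
      have h := Matrix.abs_le_norm_conj_diagonal hU lam i
      rw [← hdecomp] at h
      have := mul_le_mul_of_nonneg_left ((le_abs_self _).trans h) hη.le
      linarith
    have hb : ∀ x, spfDrift η (quadObjective A) x = Matrix.toEuclideanCLM (𝕜 := ℝ)
        (U * Matrix.diagonal (fun i => Real.log (1 - η * lam i) / η) * U.transpose) x := by
      intro x
      rw [spfDrift, hessianMatrix_quadObjective hA, gradient_quadObjective hA, hdecomp,
        Matrix.cfc_conj_diagonal hU, ← Matrix.toEuclideanCLM_mul_apply, Matrix.conj_diagonal_mul hU]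
      simp only [logQuot_mul_mul hη]
    obtain ⟨h1, h2⟩ := linearSDE_exists_and_hasLaw hU hc (hsqrt hD) hW _ x₀ hb
    refine ⟨h1, fun X hX t => ?_⟩
    have h3 := h2 X hX t
    have hmean : ∀ i, Real.exp (Real.log (1 - η * lam i) / η * t) =
        (1 - η * lam i) ^ ((t : ℝ) / η) := fun i => by
      rw [Real.rpow_def_of_pos (by linarith [hl i])]
      congr 1
      ring
    have hcov : (η ^ 2 * σ ^ 2) • (U * Matrix.diagonal (fun i => powQuot (t / η) (η * lam i)) *
        U.transpose) = (η * σ ^ 2) • (U * Matrix.diagonal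
          (fun i => expQuot t (-(2 * (Real.log (1 - η * lam i) / η)))) * U.transpose) := by
      simp only [← mul_powQuot_div hη (hl _)]
      rw [← Matrix.smul_conj_diagonal, smul_smul]
      congr 1
      ring
    rw [hcov]
    simpa only [hmean] using h3
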